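/- Let $(\Omega_0,P)$ be a probability space, $K\ge 2$ an integer, and $A,B,\tau>0$ constants with $KA\le B<1$ and $\tau\le (1-B)/K$. For every $\omega\in\Omega_0$ let $S_1(\omega),\dots,S_K(\omega):[0,1]\to[0,1]$ be similarities with contraction factors $a_1(\omega),\dots,a_K(\omega)$, where each $a_j$ is a random variable, such that for all $\omega\in\Omega_0$ $$A\le a_j(\omega)\ \ (1\le j\le K),\qquad \sum_{i=1}^K a_i(\omega)\le B,\qquad \operatorname{dist}\bigl(S_i(\omega)[0,1],S_j(\omega)[0,1]\bigr)\ge\tau\ \ (i\ne j).$$ Let $\Omega=\Omega_0^{\mathbb N}$ carry the infinite product measure $\mathbb P=P^{\mathbb N}$. For $\boldsymbol\omega=(\omega_1,\omega_2,\dots)\in\Omega$ define the random Moran set $$F_{\boldsymbol\omega}=\bigcap_{n}\ \bigcup_{i_1,\dots,i_n\in\{1,\dots,K\}}S_{i_1}(\omega_1)\circ\cdots\circ S_{i_n}(\omega_n)[0,1].$$ For $\omega\in\Omega_0$ let $d_\omega\ge 0$ be the unique solution of $\sum_{j=1}^K a_j(\omega)^{d_\omega}=1$, and put $D=\operatorname{ess\,sup}_{\omega\in\Omega_0}d_\omega$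 and $d=\operatorname{ess\,inf}_{\omega\in\Omega_0}d_\omega$. A dimension function is a map $\Phi:(0,1)\to[0,\infty)$ such that $t^{1+\Phi(t)}$ decreases (not necessarily strictly, for $t$ near $0$) to $0$ as $t$ decreases to $0$. It is small if, for all $t$ near $0$, $\Phi(t)=H(t)\,\frac{\log|\log t|}{|\log t|}$ with $H(t)\to0$ as $t\to0$. For a subset $E$ of a metric space let $N_r(E)$ be the least number of open balls of radius $r$ needed to cover $E$. The upper $\Phi$-dimension $\overline{\dim}_\Phi E$ is the infimum of all $s\in\mathbb R$ for which there are $C_1\in(0,1]$ and $C_2>0$ such that $$N_r(B(z,R)\cap E)\le C_2\,(R/r)^s\quad\text{for all } z\in E \text{ and all } 0<r\le R^{1+\Phi(R)}\le R<C_1,$$ where $B(z,R)$ is the open ball. The lower $\Phi$-dimension $\underline{\dim}_\Phi E$ is the supremum of all $s\in\mathbb R$ for which there are such $C_1,C_2$ with $N_r(B(z,R)\cap E)\ge C_2\,(R/r)^s$ for the same $z,r,R$. **Theorem.** There is a set $\Gamma\subseteq\Omega$ of full $\mathbb P$-measure such that for every $\boldsymbol\omega\in\Gamma$ and every small dimension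 function $\Phi$, $$\overline{\dim}_\Phi F_{\boldsymbol\omega}=D\qquad\text{and}\qquad\underline{\dim}_\Phi F_{\boldsymbol\omega}=d.$$ -/

import Mathlib

open Set Filter Topology MeasureTheory
open scoped ENNReal

namespace RandomMoran

noncomputable section

/-! ### Dimension functions and the upper and lower `Φ`-dimensions of a set -/

/-- A dimension function `Φ : (0,1) → [0,∞)`: the function `t ^ (1 + Φ t)` decreases to `0` as `t`
decreases to `0`. Only the values of `Φ` on `(0,1)` are used. The monotonicity is required near
`0`, so that functions such as `1 / |log t| ^ α`, for which it fails near `1`, are included. -/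
structure IsDimensionFunction (Φ : ℝ → ℝ) : Prop where
  nonneg : ∀ t ∈ Ioo (0 : ℝ) 1, 0 ≤ Φ t
  monotone : ∃ δ : ℝ, 0 < δ ∧ MonotoneOn (fun t : ℝ => t ^ (1 + Φ t)) (Ioo 0 δ)
  tendsto : Tendsto (fun t : ℝ => t ^ (1 + Φ t)) (𝓝[>] 0) (𝓝 0)

/-- A dimension function is small if `Φ t = H t * log |log t| / |log t|` near `0` for some `H` with
`H t → 0` as `t → 0`. -/
structure IsSmallDimensionFunction (Φ : ℝ → ℝ) : Prop extends IsDimensionFunction Φ where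
  small : ∃ H : ℝ → ℝ, Tendsto H (𝓝[>] 0) (𝓝 0) ∧
    ∀ᶠ t in 𝓝[>] (0 : ℝ), Φ t = H t * (Real.log |Real.log t| / |Real.log t|)

/-- The least number of open balls of radius `r` required to cover `E` (`⊤` if no finite number
suffices). -/
def coveringNumber {X : Type*} [MetricSpace X] (r : ℝ) (E : Set X) : ℕ∞ :=
  ⨅ (C : Finset X) (_ : E ⊆ ⋃ c ∈ C, Metric.ball c r), (C.card : ℕ∞)

/-- The upper `Φ`-dimension of the set `E`, in `[-∞, ∞]`. -/
def upperPhiDim {X : Type*} [MetricSpace X] (Φ : ℝ → ℝ) (E : Set X) : EReal :=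
  sInf ((fun s : ℝ => (s : EReal)) '' {s : ℝ | ∃ C₁ C₂ : ℝ, 0 < C₁ ∧ C₁ ≤ 1 ∧ 0 < C₂ ∧
    ∀ r R : ℝ, 0 < r → r ≤ R ^ (1 + Φ R) → R ^ (1 + Φ R) ≤ R → R < C₁ → ∀ z ∈ E,
      (coveringNumber r (Metric.ball z R ∩ E) : ℝ≥0∞) ≤ ENNReal.ofReal (C₂ * (R / r) ^ s)})

/-- The lower `Φ`-dimension of the set `E`, in `[-∞, ∞]`. -/
def lowerPhiDim {X : Type*} [MetricSpace X] (Φ : ℝ → ℝ) (E : Set X) : EReal :=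
  sSup ((fun s : ℝ => (s : EReal)) '' {s : ℝ | ∃ C₁ C₂ : ℝ, 0 < C₁ ∧ C₁ ≤ 1 ∧ 0 < C₂ ∧
    ∀ r R : ℝ, 0 < r → r ≤ R ^ (1 + Φ R) → R ^ (1 + Φ R) ≤ R → R < C₁ → ∀ z ∈ E,
      ENNReal.ofReal (C₂ * (R / r) ^ s) ≤ (coveringNumber r (Metric.ball z R ∩ E) : ℝ≥0∞)})

/-! ### Random iterated function systems and random Moran sets -/

/-- A random iterated function system on `[0,1]`: for each `ω`, there are `K` similarities
`S j ω` of `[0,1]` into itself with contraction factors `a j ω`, such that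
`A ≤ a j ω`, `∑ j, a j ω ≤ B`, and the images of `[0,1]` are at mutual distance at least `τ`.
The contraction factors are random variables. -/
structure RandomIFS (Ω₀ : Type*) [MeasurableSpace Ω₀] (K : ℕ) (A B τ : ℝ) where
  S : Fin K → Ω₀ → unitInterval → unitInterval
  a : Fin K → Ω₀ → ℝ
  measurable_a : ∀ j, Measurable (a j)
  dist_S : ∀ j ω x y, dist (S j ω x) (S j ω y) = a j ω * dist x y
  le_a : ∀ j ω, A ≤ a j ω
  sum_a_le : ∀ ω, ∑ j, a j ω ≤ B
  separated : ∀ ω i j, i ≠ j → ∀ x y, τ ≤ dist (S i ω x) (S j ω y)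

/-- The solution `s ≥ 0` of `∑ j, a j ^ s = 1`; existence and uniqueness are
`similarityDim_spec` and `similarityDim_unique` below. -/
def similarityDim {K : ℕ} (a : Fin K → ℝ) : ℝ :=
  sInf {s : ℝ | 0 ≤ s ∧ ∑ j, a j ^ s = 1}

theorem similarityDim_unique {K : ℕ} (hK : 1 ≤ K) {a : Fin K → ℝ}
    (h0 : ∀ j, 0 < a j) (h1 : ∀ j, a j < 1) {s : ℝ} (hs : 0 ≤ s) (hsum : ∑ j, a j ^ s = 1) :
    similarityDim a = s := by
  have hanti : StrictAnti (fun t : ℝ => ∑ j, a j ^ t) := by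
    intro x y hxy
    have : Nonempty (Fin K) := ⟨⟨0, hK⟩⟩
    exact Finset.sum_lt_sum_of_nonempty Finset.univ_nonempty
      (fun j _ => Real.rpow_lt_rpow_of_exponent_gt (h0 j) (h1 j) hxy)
  have hset : {t : ℝ | 0 ≤ t ∧ ∑ j, a j ^ t = 1} = {s} := by
    ext t
    constructor
    · rintro ⟨_, ht⟩
      exact hanti.injective (ht.trans hsum.symm)
    · rintro rfl
      exact ⟨hs, hsum⟩
  rw [similarityDim, hset, csInf_singleton]

theorem similarityDim_spec {K : ℕ} (hK : 1 ≤ K) {a : Fin K → ℝ}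
    (h0 : ∀ j, 0 < a j) (h1 : ∑ j, a j < 1) :
    0 ≤ similarityDim a ∧ ∑ j, a j ^ similarityDim a = 1 := by
  have hlt : ∀ j, a j < 1 := fun j =>
    (Finset.single_le_sum (fun i _ => (h0 i).le) (Finset.mem_univ j)).trans_lt h1
  have hcont : ContinuousOn (fun t : ℝ => ∑ j, a j ^ t) (Icc 0 1) := by
    refine continuousOn_finsetSum _ (fun j _ => ?_)
    exact (Real.continuous_const_rpow (h0 j).ne').continuousOn
  have hmem : (1 : ℝ) ∈ Icc (∑ j, a j ^ (1 : ℝ)) (∑ j, a j ^ (0 : ℝ)) := by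
    refine ⟨by simpa using h1.le, ?_⟩
    simpa using hK
  obtain ⟨s, hs, hsum⟩ := intermediate_value_Icc' zero_le_one hcont hmem
  rw [similarityDim_unique hK h0 hlt hs.1 hsum]
  exact ⟨hs.1, hsum⟩

namespace RandomIFS

variable {Ω₀ : Type*} [MeasurableSpace Ω₀] {K : ℕ} {A B τ : ℝ}

/-- `d_ω`, the nonnegative solution of `∑ j, a j ω ^ d_ω = 1`. -/
def dim (F : RandomIFS Ω₀ K A B τ) (ω : Ω₀) : ℝ :=
  similarityDim (fun j => F.a j ω)

/-- The composition `S_{w 0}(ω 0) ∘ ⋯ ∘ S_{w (n-1)}(ω (n-1))` along a word `w` of length `n`. -/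
def moranMap (F : RandomIFS Ω₀ K A B τ) (ω : ℕ → Ω₀) :
    (n : ℕ) → (Fin n → Fin K) → unitInterval → unitInterval
  | 0, _ => id
  | n + 1, w => F.moranMap ω n (Fin.init w) ∘ F.S (w (Fin.last n)) (ω n)

/-- The step `n` Moran interval with word `w`. -/
def moranInterval (F : RandomIFS Ω₀ K A B τ) (ω : ℕ → Ω₀) (n : ℕ) (w : Fin n → Fin K) :
    Set unitInterval :=
  range (F.moranMap ω n w)

/-- The random Moran set `F_ω`. -/
def moranSet (F : RandomIFS Ω₀ K A B τ) (ω : ℕ → Ω₀) : Set unitInterval :=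
  ⋂ n : ℕ, ⋃ w : Fin n → Fin K, F.moranInterval ω n w

end RandomIFS

end

end RandomMoran

/-! Splitting a Moran interval at level `n` multiplies the sum of the `s`-th powers of the ratios by
`∑ j, F.a j (ω n) ^ s`, which is at most `1` exactly when `F.dim (ω n) ≤ s`. If this holds at all
levels between scales `R` and `r`, the covering number of a piece of size `R` is at most a constant
times `(R / r) ^ s` (`coveringNumber_le_rpow`); with the opposite inequality, separation gives the
matching lower bound (`rpow_le_coveringNumber`). Almost surely every `F.dim (ω n)` lies between the
essential infimum and supremum, so the outer bounds hold for every `Φ`.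

For sharpness, let `q` be rational, below the essential supremum. By Borel–Cantelli there are almost
surely infinitely many `k` with a run of about `log k` levels from `k ^ 2` on where the dimension is
at least `q` (`exists_ae_frequently_run`). There `|log R|` has order `k ^ 2`, so a small `Φ` makes
`Φ R * |log R|` only `o(log k)`: the run is long enough for its two ends to be admissible scales
(`eventually_scale`), and exponents below `q` fail. The infimum is dual. Only countably many `q`
occur, so the null set does not depend on `Φ`. -/

namespace RandomMoran

/-! ### Sub- and superadditivity of covering numbers -/

section CoveringNumber

variable {X : Type*} [MetricSpace X] {r : ℝ}

theorem coveringNumber_mono {E E' : Set X} (h : E ⊆ E') :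
    coveringNumber r E ≤ coveringNumber r E' :=
  le_iInf₂ fun C hC => iInf₂_le C (h.trans hC)

theorem one_le_coveringNumber {E : Set X} (h : E.Nonempty) : 1 ≤ coveringNumber r E := by
  refine le_iInf₂ fun C hC => ?_
  obtain ⟨x, hx⟩ := h
  obtain ⟨c, hc, -⟩ := mem_iUnion₂.1 (hC hx)
  exact_mod_cast Finset.card_pos.2 ⟨c, hc⟩

theorem coveringNumber_le_one {E : Set X} {c : X} (h : E ⊆ Metric.ball c r) :
    coveringNumber r E ≤ 1 := by
  refine (iInf₂_le {c} (by simpa using h)).trans ?_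
  simp

theorem exists_cover_card_le {E : Set X} (h : coveringNumber r E ≠ ⊤) :
    ∃ C : Finset X, E ⊆ ⋃ c ∈ C, Metric.ball c r ∧ (C.card : ℕ∞) ≤ coveringNumber r E := by
  -- A cover beating the infimum plus one attains the infimum, since the values are integers.
  have h1 : coveringNumber r E < coveringNumber r E + 1 := (ENat.lt_add_one_iff h).2 le_rfl
  nth_rewrite 1 [coveringNumber] at h1
  obtain ⟨C, hC⟩ := iInf_lt_iff.1 h1
  obtain ⟨hC, hlt⟩ := iInf_lt_iff.1 hC
  exact ⟨C, hC, (ENat.lt_add_one_iff h).1 hlt⟩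

theorem coveringNumber_iUnion_le {ι : Type*} [Fintype ι] (E : ι → Set X) :
    coveringNumber r (⋃ j, E j) ≤ ∑ j, coveringNumber r (E j) := by
  classical
  by_cases htop : ∃ j, coveringNumber r (E j) = ⊤
  · obtain ⟨j, hj⟩ := htop
    calc coveringNumber r (⋃ j, E j) ≤ coveringNumber r (E j) := hj ▸ le_top
      _ ≤ _ := Finset.single_le_sum (f := fun j => coveringNumber r (E j))
        (fun _ _ => zero_le) (Finset.mem_univ j)
  · push Not at htop
    choose C hC hcard using fun j => exists_cover_card_le (htop j)
    refine (iInf₂_le (Finset.univ.biUnion C) ?_).trans ?_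
    · refine iUnion_subset fun j x hx => ?_
      obtain ⟨c, hc, hxc⟩ := mem_iUnion₂.1 (hC j hx)
      exact mem_iUnion₂.2 ⟨c, Finset.mem_biUnion.2 ⟨j, Finset.mem_univ j, hc⟩, hxc⟩
    · calc ((Finset.univ.biUnion C).card : ℕ∞) ≤ ((∑ j, (C j).card : ℕ) : ℕ∞) := by
            exact_mod_cast Finset.card_biUnion_le
        _ = ∑ j, ((C j).card : ℕ∞) := by push_cast; rfl
        _ ≤ _ := Finset.sum_le_sum fun j _ => hcard j

/-- Two points of one open ball are less than `2 * r` apart, so each ball of a cover meets at most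
one of the sets. -/
theorem sum_coveringNumber_le {ι : Type*} [Fintype ι] (E : ι → Set X)
    (hsep : ∀ i j, i ≠ j → ∀ x ∈ E i, ∀ y ∈ E j, 2 * r ≤ dist x y) :
    ∑ j, coveringNumber r (E j) ≤ coveringNumber r (⋃ j, E j) := by
  classical
  refine le_iInf₂ fun C hC => ?_
  let D : ι → Finset X := fun j => C.filter fun c => ∃ x ∈ E j, x ∈ Metric.ball c r
  have hdisj : ∀ i ∈ (Finset.univ : Finset ι), ∀ j ∈ (Finset.univ : Finset ι), i ≠ j →
      Disjoint (D i) (D j) := by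
    intro i _ j _ hij
    refine Finset.disjoint_left.2 fun c hi hj => ?_
    obtain ⟨-, x, hx, hxc⟩ := Finset.mem_filter.1 hi
    obtain ⟨-, y, hy, hyc⟩ := Finset.mem_filter.1 hj
    have h1 := hsep i j hij x hx y hy
    have h2 := dist_triangle_right x y c
    rw [Metric.mem_ball] at hxc hyc
    linarith
  calc ∑ j, coveringNumber r (E j) ≤ ∑ j, ((D j).card : ℕ∞) := by
        refine Finset.sum_le_sum fun j _ => iInf₂_le (D j) fun x hx => ?_
        obtain ⟨c, hc, hxc⟩ := mem_iUnion₂.1 (hC (mem_iUnion_of_mem j hx))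
        exact mem_iUnion₂.2 ⟨c, Finset.mem_filter.2 ⟨hc, x, hx, hxc⟩, hxc⟩
    _ = ((Finset.univ.biUnion D).card : ℕ∞) := by
        rw [Finset.card_biUnion hdisj]; push_cast; rfl
    _ ≤ (C.card : ℕ∞) := by
        exact_mod_cast Finset.card_le_card
          (Finset.biUnion_subset.2 fun j _ => Finset.filter_subset _ _)

theorem coe_sum_coveringNumber {ι : Type*} [Fintype ι] (E : ι → Set X) :
    ((∑ j, coveringNumber r (E j) : ℕ∞) : ℝ≥0∞) = ∑ j, (coveringNumber r (E j) : ℝ≥0∞) :=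
  map_sum ENat.toENNRealRingHom _ _

end CoveringNumber

/-! ### Geometry of Moran intervals -/

namespace RandomIFS

variable {Ω₀ : Type*} [MeasurableSpace Ω₀] {K : ℕ} {A B τ : ℝ} (F : RandomIFS Ω₀ K A B τ)
  (ω : ℕ → Ω₀)

/-- The contraction factor of `moranMap`. -/
def ratio (n : ℕ) (w : Fin n → Fin K) : ℝ := ∏ i, F.a (w i) (ω i)

theorem ratio_zero (w : Fin 0 → Fin K) : F.ratio ω 0 w = 1 := by simp [ratio]

theorem ratio_snoc {n : ℕ} (w : Fin n → Fin K) (j : Fin K) :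
    F.ratio ω (n + 1) (Fin.snoc w j) = F.ratio ω n w * F.a j (ω n) := by
  simp [ratio, Fin.prod_univ_castSucc]

theorem moranMap_snoc {n : ℕ} (w : Fin n → Fin K) (j : Fin K) :
    F.moranMap ω (n + 1) (Fin.snoc w j) = F.moranMap ω n w ∘ F.S j (ω n) := by
  simp [moranMap]

variable {F} in
theorem a_pos (hA : 0 < A) (j : Fin K) (ω₀ : Ω₀) : 0 < F.a j ω₀ := hA.trans_le (F.le_a j ω₀)

variable {F} in
theorem a_le (hA : 0 < A) (j : Fin K) (ω₀ : Ω₀) : F.a j ω₀ ≤ B :=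
  (Finset.single_le_sum (fun i _ => (a_pos (F := F) hA i ω₀).le) (Finset.mem_univ j)).trans
    (F.sum_a_le ω₀)

theorem ratio_pos (hA : 0 < A) (n : ℕ) (w : Fin n → Fin K) : 0 < F.ratio ω n w :=
  Finset.prod_pos fun i _ => a_pos hA (w i) (ω i)

theorem pow_le_ratio (hA : 0 < A) (n : ℕ) (w : Fin n → Fin K) : A ^ n ≤ F.ratio ω n w := by
  simpa [ratio] using Finset.prod_le_prod (s := (Finset.univ : Finset (Fin n)))
    (fun i _ => hA.le) (fun i _ => F.le_a (w i) (ω i))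

theorem ratio_le_pow (hA : 0 < A) (n : ℕ) (w : Fin n → Fin K) : F.ratio ω n w ≤ B ^ n := by
  simpa [ratio] using Finset.prod_le_prod (s := (Finset.univ : Finset (Fin n)))
    (fun i _ => (a_pos hA (w i) (ω i)).le) (fun i _ => a_le (F := F) hA (w i) (ω i))

theorem dist_moranMap (n : ℕ) (w : Fin n → Fin K) (x y : unitInterval) :
    dist (F.moranMap ω n w x) (F.moranMap ω n w y) = F.ratio ω n w * dist x y := by
  induction n generalizing x y with
  | zero => simp [moranMap, ratio]
  | succ n ih =>
    induction w using Fin.snocCases with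
    | snoc w j =>
      rw [moranMap_snoc, ratio_snoc, Function.comp_apply, Function.comp_apply, ih, F.dist_S,
        mul_assoc]

theorem continuous_moranMap (n : ℕ) (w : Fin n → Fin K) : Continuous (F.moranMap ω n w) :=
  (LipschitzWith.of_dist_le_mul (K := (F.ratio ω n w).toNNReal) fun x y => by
    rw [dist_moranMap]
    exact mul_le_mul_of_nonneg_right (Real.le_coe_toNNReal _) dist_nonneg).continuous

theorem dist_le_of_mem_moranInterval (hA : 0 < A) {n : ℕ} {w : Fin n → Fin K}
    {x y : unitInterval} (hx : x ∈ F.moranInterval ω n w) (hy : y ∈ F.moranInterval ω n w) :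
    dist x y ≤ F.ratio ω n w := by
  obtain ⟨x, rfl⟩ := hx
  obtain ⟨y, rfl⟩ := hy
  rw [dist_moranMap]
  refine mul_le_of_le_one_right (F.ratio_pos ω hA n w).le ?_
  rw [Subtype.dist_eq, Real.dist_eq, abs_le]
  constructor <;> linarith [x.2.1, x.2.2, y.2.1, y.2.2]

theorem moranInterval_snoc_subset {n : ℕ} (w : Fin n → Fin K) (j : Fin K) :
    F.moranInterval ω (n + 1) (Fin.snoc w j) ⊆ F.moranInterval ω n w := by
  rw [moranInterval, moranMap_snoc]
  exact range_comp_subset_range _ _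

theorem le_dist_of_mem_snoc (hA : 0 < A) {n : ℕ} {w : Fin n → Fin K} {i j : Fin K} (hij : i ≠ j)
    {x y : unitInterval} (hx : x ∈ F.moranInterval ω (n + 1) (Fin.snoc w i))
    (hy : y ∈ F.moranInterval ω (n + 1) (Fin.snoc w j)) :
    τ * F.ratio ω n w ≤ dist x y := by
  rw [moranInterval, moranMap_snoc] at hx hy
  obtain ⟨x, rfl⟩ := hx
  obtain ⟨y, rfl⟩ := hy
  rw [Function.comp_apply, Function.comp_apply, dist_moranMap, mul_comm]
  exact mul_le_mul_of_nonneg_left (F.separated _ i j hij x y) (F.ratio_pos ω hA n w).le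

/-- Remove last letters until the parents agree; siblings are then separated relative to their
parent, whose ratio is larger. -/
theorem le_dist_of_mem_moranInterval (hA : 0 < A) (hB : B < 1) (hτ : 0 < τ) {n : ℕ}
    {v w : Fin n → Fin K} (hvw : v ≠ w) {x y : unitInterval}
    (hx : x ∈ F.moranInterval ω n v) (hy : y ∈ F.moranInterval ω n w) :
    τ * F.ratio ω n w ≤ dist x y := by
  induction n with
  | zero => exact absurd (Subsingleton.elim v w) hvw
  | succ n ih =>
    induction v using Fin.snocCases with
    | snoc v i =>
    induction w using Fin.snocCases with
    | snoc w j =>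
      have hle : F.ratio ω (n + 1) (Fin.snoc w j) ≤ F.ratio ω n w := by
        rw [ratio_snoc]
        exact mul_le_of_le_one_right (F.ratio_pos ω hA n w).le ((a_le hA j _).trans hB.le)
      refine (mul_le_mul_of_nonneg_left hle hτ.le).trans ?_
      by_cases h : v = w
      · subst h
        refine F.le_dist_of_mem_snoc ω hA (fun hij => hvw (by rw [hij])) hx hy
      · exact ih h (F.moranInterval_snoc_subset ω v i hx) (F.moranInterval_snoc_subset ω w j hy)

theorem eq_of_mem_moranInterval (hA : 0 < A) (hB : B < 1) (hτ : 0 < τ) {n : ℕ}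
    {v w : Fin n → Fin K} {x : unitInterval}
    (hx : x ∈ F.moranInterval ω n v) (hy : x ∈ F.moranInterval ω n w) : v = w := by
  by_contra h
  have h1 := F.le_dist_of_mem_moranInterval ω hA hB hτ h hx hy
  rw [dist_self] at h1
  exact absurd h1 (not_le.2 (mul_pos hτ (F.ratio_pos ω hA n w)))

theorem moranSet_inter_moranInterval (hA : 0 < A) (hB : B < 1) (hτ : 0 < τ) {n : ℕ}
    (w : Fin n → Fin K) :
    F.moranSet ω ∩ F.moranInterval ω n w =
      ⋃ j, F.moranSet ω ∩ F.moranInterval ω (n + 1) (Fin.snoc w j) := by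
  refine Subset.antisymm ?_ (iUnion_subset fun j =>
    inter_subset_inter_right _ (F.moranInterval_snoc_subset ω w j))
  rintro x ⟨hx, hxw⟩
  obtain ⟨v, hv⟩ := mem_iUnion.1 (mem_iInter.1 hx (n + 1))
  induction v using Fin.snocCases with
  | snoc v j =>
    obtain rfl := F.eq_of_mem_moranInterval ω hA hB hτ (F.moranInterval_snoc_subset ω v j hv) hxw
    exact mem_iUnion.2 ⟨j, hx, hv⟩

theorem isClosed_moranInterval (n : ℕ) (w : Fin n → Fin K) :
    IsClosed (F.moranInterval ω n w) :=
  (isCompact_range (F.continuous_moranMap ω n w)).isClosed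

/-- Cantor's intersection theorem for the level unions cut down to the interval of `w`; extensions
of `w` show that they are nonempty. -/
theorem nonempty_moranSet_inter (hK : 0 < K) {n : ℕ} (w : Fin n → Fin K) :
    (F.moranSet ω ∩ F.moranInterval ω n w).Nonempty := by
  let M : ℕ → Set unitInterval := fun k =>
    (⋃ v : Fin k → Fin K, F.moranInterval ω k v) ∩ F.moranInterval ω n w
  have hanti : Antitone M := by
    refine antitone_nat_of_succ_le fun k => inter_subset_inter_left _ (iUnion_subset fun v => ?_)
    induction v using Fin.snocCases with
    | snoc v j => exact (F.moranInterval_snoc_subset ω v j).trans (subset_iUnion _ v)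
  have hclosed : ∀ k, IsClosed (M k) := fun k =>
    (isClosed_iUnion_of_finite fun v => F.isClosed_moranInterval ω k v).inter
      (F.isClosed_moranInterval ω n w)
  have hext : ∀ k, ∃ v : Fin (n + k) → Fin K,
      F.moranInterval ω (n + k) v ⊆ F.moranInterval ω n w := by
    intro k
    induction k with
    | zero => exact ⟨w, subset_rfl⟩
    | succ k ih =>
      obtain ⟨v, hv⟩ := ih
      exact ⟨Fin.snoc v ⟨0, hK⟩, (F.moranInterval_snoc_subset ω v _).trans hv⟩
  have hne : ∀ k, (M k).Nonempty := by
    intro k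
    obtain ⟨v, hv⟩ := hext k
    refine Nonempty.mono (hanti (Nat.le_add_left k n)) ?_
    exact ⟨F.moranMap ω _ v 0, mem_iUnion_of_mem v (mem_range_self _), hv (mem_range_self _)⟩
  obtain ⟨x, hx⟩ := IsCompact.nonempty_iInter_of_sequence_nonempty_isCompact_isClosed M
    (fun k => hanti k.le_succ) hne (hclosed 0).isCompact hclosed
  rw [mem_iInter] at hx
  exact ⟨x, mem_iInter.2 fun k => (hx k).1, (hx 0).2⟩

/-- Stop at the first level where the ratio is below `t`: the parent still has ratio at least `t`,
and the last factor is at least `A`. -/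
theorem exists_ratio_mem_Ico (hA : 0 < A) (hB : B < 1) {z : unitInterval}
    (hz : z ∈ F.moranSet ω) {t : ℝ} (ht : 0 < t) (ht1 : t ≤ 1) :
    ∃ (n : ℕ) (w : Fin n → Fin K), z ∈ F.moranInterval ω n w ∧
      A * t ≤ F.ratio ω n w ∧ F.ratio ω n w < t := by
  have hex : ∃ n, ∃ w : Fin n → Fin K, z ∈ F.moranInterval ω n w ∧ F.ratio ω n w < t := by
    have hK : 0 < K := by
      obtain ⟨w, -⟩ := mem_iUnion.1 (mem_iInter.1 hz 1)
      exact (w 0).pos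
    obtain ⟨n, hn⟩ := exists_pow_lt_of_lt_one ht hB
    obtain ⟨w, hw⟩ := mem_iUnion.1 (mem_iInter.1 hz n)
    exact ⟨n, w, hw, (F.ratio_le_pow ω hA n w).trans_lt hn⟩
  classical
  obtain ⟨w, hw, hlt⟩ := Nat.find_spec hex
  have hmin := fun m => Nat.find_min hex (m := m)
  generalize Nat.find hex = n at w hmin
  refine ⟨n, w, hw, ?_, hlt⟩
  cases n with
  | zero => rw [ratio_zero] at hlt; linarith
  | succ n =>
    induction w using Fin.snocCases with
    | snoc w j =>
      have h := hmin n n.lt_succ_self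
      push Not at h
      have h1 := h w (F.moranInterval_snoc_subset ω w j hw)
      rw [ratio_snoc, mul_comm]
      exact mul_le_mul h1 (F.le_a j _) hA.le (F.ratio_pos ω hA n w).le

theorem ball_inter_moranSet_subset (hA : 0 < A) (hB : B < 1) (hτ : 0 < τ) {n : ℕ}
    {w : Fin n → Fin K} {z : unitInterval} (hz : z ∈ F.moranInterval ω n w) {R : ℝ}
    (hR : R ≤ τ * F.ratio ω n w) :
    Metric.ball z R ∩ F.moranSet ω ⊆ F.moranSet ω ∩ F.moranInterval ω n w := by
  rintro y ⟨hy, hyF⟩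
  refine ⟨hyF, ?_⟩
  obtain ⟨v, hv⟩ := mem_iUnion.1 (mem_iInter.1 hyF n)
  by_cases h : v = w
  · exact h ▸ hv
  · have := F.le_dist_of_mem_moranInterval ω hA hB hτ h hv hz
    rw [Metric.mem_ball] at hy
    linarith

theorem subset_ball_inter_moranSet (hA : 0 < A) {n : ℕ}
    {w : Fin n → Fin K} {z : unitInterval} (hz : z ∈ F.moranInterval ω n w) {R : ℝ}
    (hR : F.ratio ω n w < R) :
    F.moranSet ω ∩ F.moranInterval ω n w ⊆ Metric.ball z R ∩ F.moranSet ω := fun _ hy =>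
  ⟨Metric.mem_ball.2 ((F.dist_le_of_mem_moranInterval ω hA hy.2 hz).trans_lt hR), hy.1⟩

/-! ### Covering numbers of Moran pieces by a stopping argument -/

theorem pow_mul_ratio_snoc_le (hA : 0 < A) {m n : ℕ} {w : Fin n → Fin K} {x : ℝ}
    (h : B ^ (m + 1) * F.ratio ω n w ≤ x) (j : Fin K) :
    B ^ m * F.ratio ω (n + 1) (Fin.snoc w j) ≤ x := by
  have hB0 : 0 ≤ B := (a_pos hA j (ω 0)).le.trans (a_le (F := F) hA j (ω 0))
  have ha := a_le (F := F) hA j (ω n)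
  rw [ratio_snoc]
  calc B ^ m * (F.ratio ω n w * F.a j (ω n)) ≤ B ^ m * (F.ratio ω n w * B) := by
        have := (F.ratio_pos ω hA n w).le
        gcongr
    _ = B ^ (m + 1) * F.ratio ω n w := by ring
    _ ≤ x := h

/-- Split intervals until their ratio is at most `x`. A stopped interval fits in one ball and still
has ratio at least `A * x`, so it contributes at most its power on the right; splitting does not
increase the sum of these powers. The depth is at most `m`, so only `m` levels need the hypothesis.
-/
theorem coveringNumber_le_rpow (hA : 0 < A) (hB : B < 1) (hτ : 0 < τ) {s r x : ℝ}
    (hs : 0 ≤ s) (hx : 0 < x) (hxr : x < r) (m : ℕ) {n : ℕ} (w : Fin n → Fin K)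
    (hm : B ^ m * F.ratio ω n w ≤ x) (hxw : A * x ≤ F.ratio ω n w)
    (hsum : ∀ i < m, ∑ j, F.a j (ω (n + i)) ^ s ≤ 1) :
    (coveringNumber r (F.moranSet ω ∩ F.moranInterval ω n w) : ℝ≥0∞) ≤
      ENNReal.ofReal ((F.ratio ω n w / (A * x)) ^ s) := by
  have hbase : ∀ {n : ℕ} (w : Fin n → Fin K), F.ratio ω n w ≤ x → A * x ≤ F.ratio ω n w →
      (coveringNumber r (F.moranSet ω ∩ F.moranInterval ω n w) : ℝ≥0∞) ≤
      ENNReal.ofReal ((F.ratio ω n w / (A * x)) ^ s) := by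
    intro n w h1 h2
    have h3 : coveringNumber r (F.moranSet ω ∩ F.moranInterval ω n w) ≤ 1 :=
      coveringNumber_le_one (c := F.moranMap ω n w 0) fun y hy => Metric.mem_ball.2
        ((F.dist_le_of_mem_moranInterval ω hA hy.2 (mem_range_self _)).trans_lt
          (h1.trans_lt hxr))
    calc (coveringNumber r (F.moranSet ω ∩ F.moranInterval ω n w) : ℝ≥0∞) ≤ 1 := by
          exact_mod_cast h3
      _ ≤ _ := ENNReal.one_le_ofReal.2
        (Real.one_le_rpow ((one_le_div (by positivity)).2 h2) hs)
  induction m generalizing n with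
  | zero => exact hbase w (by simpa using hm) hxw
  | succ m ih =>
    by_cases hwx : F.ratio ω n w ≤ x
    · exact hbase w hwx hxw
    · have hρ := F.ratio_pos ω hA n w
      rw [F.moranSet_inter_moranInterval ω hA hB hτ]
      calc ((coveringNumber r (⋃ j, F.moranSet ω ∩
            F.moranInterval ω (n + 1) (Fin.snoc w j)) : ℕ∞) : ℝ≥0∞)
          ≤ ∑ j, (coveringNumber r (F.moranSet ω ∩
            F.moranInterval ω (n + 1) (Fin.snoc w j)) : ℝ≥0∞) := by
            rw [← coe_sum_coveringNumber]
            exact_mod_cast coveringNumber_iUnion_le _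
        _ ≤ ∑ j, ENNReal.ofReal ((F.ratio ω (n + 1) (Fin.snoc w j) / (A * x)) ^ s) := by
            refine Finset.sum_le_sum fun j _ => ih (Fin.snoc w j)
              (F.pow_mul_ratio_snoc_le ω hA hm j) ?_ fun i hi => ?_
            · rw [ratio_snoc, mul_comm]
              exact mul_le_mul (not_le.1 hwx).le (F.le_a j _) hA.le hρ.le
            · have := hsum (i + 1) (by omega)
              rwa [← add_assoc, add_right_comm] at this
        _ = ENNReal.ofReal (∑ j, (F.ratio ω n w / (A * x)) ^ s * F.a j (ω n) ^ s) := by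
            rw [ENNReal.ofReal_sum_of_nonneg fun j _ => mul_nonneg
              (Real.rpow_nonneg (by positivity) _) (Real.rpow_nonneg (a_pos hA _ _).le _)]
            refine Finset.sum_congr rfl fun j _ => ?_
            rw [ratio_snoc, ← Real.mul_rpow (by positivity) (a_pos hA _ _).le,
              mul_div_right_comm]
        _ ≤ _ := by
            rw [← Finset.mul_sum]
            exact ENNReal.ofReal_le_ofReal (mul_le_of_le_one_right
              (Real.rpow_nonneg (by positivity) _) (by simpa using hsum 0 (by omega)))

/-- Same stopping rule. Only intervals of ratio above `x` are split, so the children are at least `τ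
* x ≥ 2 * r` apart and the covering numbers add; a stopped piece is nonempty and counts at least
`1`. -/
theorem rpow_le_coveringNumber (hK : 0 < K) (hA : 0 < A) (hB : B < 1) (hτ : 0 < τ) {s r x : ℝ}
    (hs : 0 ≤ s) (hx : 0 < x) (hxr : 2 * r ≤ τ * x) (m : ℕ) {n : ℕ} (w : Fin n → Fin K)
    (hm : B ^ m * F.ratio ω n w ≤ x)
    (hsum : ∀ i < m, 1 ≤ ∑ j, F.a j (ω (n + i)) ^ s) :
    ENNReal.ofReal ((F.ratio ω n w / x) ^ s) ≤
      (coveringNumber r (F.moranSet ω ∩ F.moranInterval ω n w) : ℝ≥0∞) := by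
  have hbase : ∀ {n : ℕ} (w : Fin n → Fin K), F.ratio ω n w ≤ x →
      ENNReal.ofReal ((F.ratio ω n w / x) ^ s) ≤
      (coveringNumber r (F.moranSet ω ∩ F.moranInterval ω n w) : ℝ≥0∞) := by
    intro n w h1
    calc ENNReal.ofReal ((F.ratio ω n w / x) ^ s) ≤ 1 :=
          ENNReal.ofReal_le_one.2 (Real.rpow_le_one (div_nonneg (F.ratio_pos ω hA n w).le hx.le)
            ((div_le_one hx).2 h1) hs)
      _ ≤ _ := by exact_mod_cast one_le_coveringNumber (F.nonempty_moranSet_inter ω hK w)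
  induction m generalizing n with
  | zero => exact hbase w (by simpa using hm)
  | succ m ih =>
    by_cases hwx : F.ratio ω n w ≤ x
    · exact hbase w hwx
    · have hρ := F.ratio_pos ω hA n w
      rw [F.moranSet_inter_moranInterval ω hA hB hτ]
      calc ENNReal.ofReal ((F.ratio ω n w / x) ^ s)
          ≤ ENNReal.ofReal (∑ j, (F.ratio ω n w / x) ^ s * F.a j (ω n) ^ s) := by
            rw [← Finset.mul_sum]
            exact ENNReal.ofReal_le_ofReal (le_mul_of_one_le_right
              (Real.rpow_nonneg (by positivity) _) (by simpa using hsum 0 (by omega)))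
        _ = ∑ j, ENNReal.ofReal ((F.ratio ω (n + 1) (Fin.snoc w j) / x) ^ s) := by
            rw [ENNReal.ofReal_sum_of_nonneg fun j _ => mul_nonneg
              (Real.rpow_nonneg (by positivity) _) (Real.rpow_nonneg (a_pos hA _ _).le _)]
            refine Finset.sum_congr rfl fun j _ => ?_
            rw [ratio_snoc, ← Real.mul_rpow (by positivity) (a_pos hA _ _).le,
              mul_div_right_comm]
        _ ≤ ∑ j, (coveringNumber r (F.moranSet ω ∩
            F.moranInterval ω (n + 1) (Fin.snoc w j)) : ℝ≥0∞) := by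
            refine Finset.sum_le_sum fun j _ => ih (Fin.snoc w j)
              (F.pow_mul_ratio_snoc_le ω hA hm j) fun i hi => ?_
            have := hsum (i + 1) (by omega)
            rwa [← add_assoc, add_right_comm] at this
        _ ≤ _ := by
            rw [← coe_sum_coveringNumber, ENat.toENNReal_le]
            refine sum_coveringNumber_le _ fun i j hij y hy z hz => ?_
            refine hxr.trans (le_trans ?_ (F.le_dist_of_mem_snoc ω hA hij hy.2 hz.2))
            exact mul_le_mul_of_nonneg_left (not_le.1 hwx).le hτ.le

end RandomIFS

/-! ### Long runs in an independent sequence -/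

theorem iIndepSet_pi_of_pairwise_disjoint {Ω₀ : Type*} [MeasurableSpace Ω₀] (P : Measure Ω₀)
    [IsProbabilityMeasure P] {G : Set Ω₀} (hG : MeasurableSet G) {T : ℕ → Finset ℕ}
    (hT : Pairwise fun k l => Disjoint (T k) (T l)) :
    ProbabilityTheory.iIndepSet (fun k => Set.pi (T k : Set ℕ) fun _ => G)
      (Measure.infinitePi fun _ : ℕ => P) := by
  have hmeas : ∀ k, MeasurableSet (Set.pi (T k : Set ℕ) fun _ => G) := fun k =>
    MeasurableSet.pi (T k).countable_toSet fun _ _ => hG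
  rw [ProbabilityTheory.iIndepSet_iff_meas_biInter hmeas]
  intro s
  have hset : (⋂ k ∈ s, Set.pi (T k : Set ℕ) fun _ => G) =
      Set.pi (s.biUnion T : Set ℕ) fun _ => G := by
    ext ω
    simp only [mem_iInter, Set.mem_pi, Finset.coe_biUnion, mem_iUnion, Finset.mem_coe]
    grind
  rw [hset, Measure.infinitePi_pi _ fun _ _ => hG, Finset.prod_biUnion fun k _ l _ hkl => hT hkl]
  exact Finset.prod_congr rfl fun k _ => (Measure.infinitePi_pi _ fun _ _ => hG).symm

/-- Almost every sequence has, for infinitely many `k`, a run of length `Nat.log b (k + 1)` in a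
given set of positive measure, starting at `k ^ 2`. -/
theorem exists_ae_frequently_run {Ω₀ : Type*} [MeasurableSpace Ω₀] (P : Measure Ω₀)
    [IsProbabilityMeasure P] {G : Set Ω₀} (hG : MeasurableSet G) (hPG : P G ≠ 0) :
    ∃ b : ℕ, 2 ≤ b ∧ ∀ᵐ ω ∂(Measure.infinitePi fun _ : ℕ => P),
      ∃ᶠ k in atTop, ∀ i < Nat.log b (k + 1), ω (k ^ 2 + i) ∈ G := by
  obtain ⟨b₀, hb₀⟩ := ENNReal.exists_inv_nat_lt hPG
  let b := b₀ + 2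
  have hb : ((b : ℕ) : ℝ≥0∞)⁻¹ ≤ P G :=
    (ENNReal.inv_le_inv.2 (by exact_mod_cast Nat.le_add_right b₀ 2)).trans hb₀.le
  have hb1 : 1 < b := by omega
  refine ⟨b, by omega, ?_⟩
  let T : ℕ → Finset ℕ := fun k => Finset.Ico (k ^ 2) (k ^ 2 + Nat.log b (k + 1))
  -- The blocks are disjoint because `k ^ 2 + k < (k + 1) ^ 2`.
  have hlog : ∀ k, Nat.log b (k + 1) ≤ k := fun k =>
    Nat.lt_succ_iff.1 (Nat.log_lt_self b k.succ_ne_zero)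
  have hT : Pairwise fun k l => Disjoint (T k) (T l) := by
    refine (pairwise_disjoint_on T).2 fun k l hkl => Finset.disjoint_left.2 fun i hi hi' => ?_
    have h1 := (Finset.mem_Ico.1 hi).2
    have h2 := (Finset.mem_Ico.1 hi').1
    have h3 := hlog k
    nlinarith
  have hmeas : ∀ k, MeasurableSet (Set.pi (T k : Set ℕ) fun _ => G) := fun k =>
    MeasurableSet.pi (T k).countable_toSet fun _ _ => hG
  -- The logarithm to base `b`, with `1 / b ≤ P G`, keeps the run probability above the harmonic
  -- terms.
  have hge : ∀ k : ℕ, ((k + 1 : ℕ) : ℝ≥0∞)⁻¹ ≤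
      (Measure.infinitePi fun _ : ℕ => P) (Set.pi (T k : Set ℕ) fun _ => G) := by
    intro k
    rw [Measure.infinitePi_pi _ fun _ _ => hG, Finset.prod_const, Nat.card_Ico,
      Nat.add_sub_cancel_left]
    calc ((k + 1 : ℕ) : ℝ≥0∞)⁻¹ ≤ ((b ^ Nat.log b (k + 1) : ℕ) : ℝ≥0∞)⁻¹ :=
          ENNReal.inv_le_inv.2 (by exact_mod_cast Nat.pow_log_le_self b k.succ_ne_zero)
      _ = ((b : ℝ≥0∞)⁻¹) ^ Nat.log b (k + 1) := by rw [Nat.cast_pow, ENNReal.inv_pow]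
      _ ≤ _ := pow_le_pow_left' hb _
  have hdiv : ∑' k : ℕ, ((k + 1 : ℕ) : ℝ≥0∞)⁻¹ = ⊤ := by
    by_contra h
    refine Real.not_summable_natCast_inv ((summable_nat_add_iff 1).1 ?_)
    exact (ENNReal.summable_toReal h).congr fun k => by
      rw [ENNReal.toReal_inv, ENNReal.toReal_natCast]
  have htsum : ∑' k, (Measure.infinitePi fun _ : ℕ => P) (Set.pi (T k : Set ℕ) fun _ => G) = ⊤ :=
    top_unique (hdiv ▸ ENNReal.tsum_le_tsum hge)
  have hone := ProbabilityTheory.measure_limsup_eq_one hmeas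
    (iIndepSet_pi_of_pairwise_disjoint P hG hT) htsum
  have hae := (mem_ae_iff_prob_eq_one (MeasurableSet.measurableSet_limsup hmeas)).2 hone
  filter_upwards [hae] with ω hω
  refine (mem_limsup_iff_frequently_mem.1 hω).mono fun k hk i hi => ?_
  exact hk (k ^ 2 + i) (by simpa [T] using hi)

/-! ### Small dimension functions at the scales of the runs -/

theorem IsSmallDimensionFunction.eventually_mul_abs_log_le {Φ : ℝ → ℝ}
    (hΦ : IsSmallDimensionFunction Φ) {h : ℝ} (hh : 0 < h) :
    ∀ᶠ t in 𝓝[>] (0 : ℝ), Φ t * |Real.log t| ≤ h * Real.log |Real.log t| := by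
  obtain ⟨H, hH, hΦH⟩ := hΦ.small
  have hlt : ∀ᶠ t in 𝓝[>] (0 : ℝ), t < Real.exp (-1) :=
    eventually_nhdsWithin_of_eventually_nhds (eventually_lt_nhds (Real.exp_pos _))
  filter_upwards [hΦH, hH.eventually_lt_const hh, hlt, self_mem_nhdsWithin] with t h1 h2 h3 h4
  have hlog : 1 < |Real.log t| := by
    have := (Real.log_lt_iff_lt_exp h4).2 h3
    rw [abs_of_neg (by linarith)]
    linarith
  rw [h1, mul_assoc, div_mul_cancel₀ _ (by positivity)]
  exact mul_le_mul_of_nonneg_right h2.le (Real.log_nonneg hlog.le)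

theorem tendsto_natLog_succ {b : ℕ} (hb : 2 ≤ b) :
    Tendsto (fun k : ℕ => Nat.log b (k + 1)) atTop atTop := by
  refine tendsto_atTop.2 fun M => ?_
  filter_upwards [eventually_ge_atTop (b ^ M)] with k hk
  exact Nat.le_log_of_pow_le hb (by omega)

/-- Here `ρ` stands for a ratio at level `k ^ 2` and `m = Nat.log b (k + 1)` for the run length.
With `R = α * ρ` and `r = β * (B ^ m * ρ)`, the gap `log (R / r)` is `m * |log B|` up to a constant,
while `Φ R * |log R|` is at most `(m + 1) * |log B| / 2`; the remaining half absorbs the constants.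
-/
theorem IsSmallDimensionFunction.eventually_scale {Φ : ℝ → ℝ} (hΦ : IsSmallDimensionFunction Φ)
    {A B : ℝ} (hA : 0 < A) (hB0 : 0 < B) (hB : B < 1) {α β δ : ℝ} (hα : 0 < α) (hβ : 0 < β)
    (hδ : 0 < δ) {b : ℕ} (hb : 2 ≤ b) :
    ∀ᶠ k : ℕ in atTop, ∀ ρ : ℝ, A ^ (k ^ 2) ≤ ρ → ρ ≤ B ^ (k ^ 2) →
      α * ρ < δ ∧ β * (B ^ Nat.log b (k + 1) * ρ) ≤ (α * ρ) ^ (1 + Φ (α * ρ)) ∧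
        (α * ρ) ^ (1 + Φ (α * ρ)) ≤ α * ρ := by
  have hLb : 0 < Real.log b := Real.log_pos (by exact_mod_cast hb)
  have hLB : 0 < -Real.log B := by linarith [Real.log_neg hB0 hB]
  obtain ⟨ε, hε, hsmall⟩ := mem_nhdsGT_iff_exists_Ioo_subset.1
    -- The `6` is `3 * 2`: a factor `3` from the cubic bound on `|log (α * ρ)|` below, and `2` to
    -- spend only half of `m * |log B|`.
    (hΦ.eventually_mul_abs_log_le (h := -Real.log B / (6 * Real.log b)) (by positivity))
  have hε : 0 < ε := hε
  have hm : ∀ᶠ k : ℕ in atTop, Real.log β - Real.log α + -Real.log B / 2 ≤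
      (Nat.log b (k + 1) : ℝ) * (-Real.log B / 2) :=
    ((tendsto_natCast_atTop_atTop.comp (tendsto_natLog_succ hb)).atTop_mul_const
      (by positivity)).eventually_ge_atTop _
  have hBk : Tendsto (fun k : ℕ => α * B ^ (k ^ 2)) atTop (𝓝 0) := by
    simpa using ((tendsto_pow_atTop_nhds_zero_of_lt_one hB0.le hB).comp
      (tendsto_pow_atTop two_ne_zero)).const_mul α
  have hc : ∀ᶠ k : ℕ in atTop, |Real.log A| + |Real.log α| ≤ (k : ℝ) :=
    tendsto_natCast_atTop_atTop.eventually_ge_atTop _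
  filter_upwards [hm, hc, hBk.eventually_lt_const hδ, hBk.eventually_lt_const hε,
    hBk.eventually_lt_const one_pos] with k hm hc h1 h2 h3 ρ hρA hρB
  have hρ : 0 < ρ := (pow_pos hA _).trans_le hρA
  have hle : α * ρ ≤ α * B ^ (k ^ 2) := mul_le_mul_of_nonneg_left hρB hα.le
  have hpos : 0 < α * ρ := mul_pos hα hρ
  have hlt1 := hle.trans_lt h3
  refine ⟨hle.trans_lt h1, ?_, ?_⟩
  · have hΦρ : Φ (α * ρ) * |Real.log (α * ρ)| ≤
        -Real.log B / (6 * Real.log b) * Real.log |Real.log (α * ρ)| :=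
      hsmall ⟨hpos, hle.trans_lt h2⟩
    have hneg := Real.log_neg hpos hlt1
    have hlogρ : (k : ℝ) ^ 2 * Real.log A ≤ Real.log ρ := by
      have := Real.log_le_log (pow_pos hA _) hρA
      rw [Real.log_pow] at this
      exact_mod_cast this
    have hmul : Real.log (α * ρ) = Real.log α + Real.log ρ := Real.log_mul hα.ne' hρ.ne'
    -- The true order is `k ^ 2`; the extra factor absorbs `|log A| + |log α|`, and only the
    -- logarithm of this bound matters.
    have hcube : |Real.log (α * ρ)| ≤ ((k : ℝ) + 1) ^ 3 := by
      rw [abs_of_neg hneg, hmul]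
      have hk : (0 : ℝ) ≤ k := k.cast_nonneg
      have hα' := neg_abs_le (Real.log α)
      have hα'' := abs_nonneg (Real.log α)
      have e1 : |Real.log α| ≤ ((k : ℝ) + 1) ^ 2 * |Real.log α| :=
        le_mul_of_one_le_left hα'' (by nlinarith)
      have e2 : ((k : ℝ) + 1) ^ 2 * (|Real.log A| + |Real.log α|) ≤ ((k : ℝ) + 1) ^ 2 * (k + 1) :=
        mul_le_mul_of_nonneg_left (by linarith) (by positivity)
      have e3 : (k : ℝ) ^ 2 * -|Real.log A| ≤ (k : ℝ) ^ 2 * Real.log A :=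
        mul_le_mul_of_nonneg_left (neg_abs_le _) (sq_nonneg _)
      have e4 : (k : ℝ) ^ 2 * |Real.log A| ≤ ((k : ℝ) + 1) ^ 2 * |Real.log A| := by
        gcongr
        linarith
      linarith
    have hloglog : Real.log |Real.log (α * ρ)| ≤
        3 * ((Nat.log b (k + 1) + 1) * Real.log b) := by
      have e1 := Real.log_le_log (abs_pos.2 hneg.ne) hcube
      have e2 : ((k : ℝ) + 1) ≤ (b : ℝ) ^ (Nat.log b (k + 1) + 1) := by
        exact_mod_cast (Nat.lt_pow_succ_log_self hb (k + 1)).le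
      have e3 := Real.log_le_log (by positivity) e2
      rw [Real.log_pow] at e1 e3
      push_cast at e1 e3
      linarith
    have hΦρ' : Φ (α * ρ) * |Real.log (α * ρ)| ≤
        (Nat.log b (k + 1) + 1) * (-Real.log B / 2) := by
      refine hΦρ.trans ((mul_le_mul_of_nonneg_left hloglog (by positivity)).trans_eq ?_)
      field_simp
      ring
    rw [abs_of_neg hneg] at hΦρ'
    rw [← Real.log_le_log_iff (by positivity) (Real.rpow_pos_of_pos hpos _), Real.log_rpow hpos,
      Real.log_mul hβ.ne' (by positivity), Real.log_mul (by positivity) hρ.ne', Real.log_pow]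
    nlinarith
  · exact (Real.rpow_le_rpow_of_exponent_ge hpos hlt1.le
      (by linarith [hΦ.nonneg _ ⟨hpos, hlt1⟩])).trans_eq (Real.rpow_one _)

theorem eventually_mul_rpow_lt {s q c c' : ℝ} (hsq : s < q) (hc : 0 < c) :
    ∀ᶠ y : ℝ in atTop, c' * y ^ s < c * y ^ q := by
  filter_upwards [(tendsto_rpow_atTop (sub_pos.2 hsq)).eventually_gt_atTop (c' / c),
    eventually_gt_atTop 0] with y hy hy0
  rw [Real.rpow_sub hy0, div_lt_div_iff₀ hc (Real.rpow_pos_of_pos hy0 s)] at hy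
  linarith

theorem tendsto_inv_pow_natLog {B : ℝ} (hB0 : 0 < B) (hB : B < 1) {b : ℕ} (hb : 2 ≤ b) :
    Tendsto (fun k : ℕ => (B ^ Nat.log b (k + 1))⁻¹) atTop atTop := by
  have := (tendsto_pow_atTop_atTop_of_one_lt ((one_lt_inv₀ hB0).2 hB)).comp
    (tendsto_natLog_succ hb)
  simpa [Function.comp_def] using this

/-! ### Bounds for the `Φ`-dimensions -/

namespace RandomIFS

variable {Ω₀ : Type*} [MeasurableSpace Ω₀] {K : ℕ} {A B τ : ℝ} (F : RandomIFS Ω₀ K A B τ)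
  (ω : ℕ → Ω₀)

theorem upperPhiDim_le (hA : 0 < A) (hA1 : A ≤ 1) (hB : B < 1) (hτ : 0 < τ) (hτ1 : τ ≤ 1)
    {s : ℝ} (hs : 0 ≤ s) (hsum : ∀ n, ∑ j, F.a j (ω n) ^ s ≤ 1) (Φ : ℝ → ℝ) :
    upperPhiDim Φ (F.moranSet ω) ≤ s := by
  refine sInf_le ⟨s, ⟨τ * A, (2 / (τ * A ^ 2)) ^ s, by positivity,
    mul_le_one₀ hτ1 hA.le hA1, by positivity, ?_⟩, rfl⟩
  intro r R hr hrR hRR hR z hz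
  have hrR' := hrR.trans hRR
  have hR0 : 0 < R := hr.trans_le hrR'
  -- This `t` makes the ratio at least `R / τ`, so the ball sees only this interval; `R < τ * A`
  -- gives `t ≤ 1`.
  obtain ⟨n, w, hzw, h1, h2⟩ := F.exists_ratio_mem_Ico ω hA hB hz (t := R / (τ * A))
    (by positivity) ((div_le_one (by positivity)).2 hR.le)
  have h1' : R ≤ τ * F.ratio ω n w := by
    have : τ * (A * (R / (τ * A))) = R := by field_simp
    nlinarith
  have hρ := F.ratio_pos ω hA n w
  obtain ⟨m, hm⟩ := exists_pow_lt_of_lt_one (show 0 < r / 2 / F.ratio ω n w by positivity) hB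
  have hAr : A * (r / 2) ≤ F.ratio ω n w := by
    have e1 : A * (r / 2) ≤ r := by nlinarith
    have e2 : τ * F.ratio ω n w ≤ F.ratio ω n w := mul_le_of_le_one_left hρ.le hτ1
    linarith
  calc (coveringNumber r (Metric.ball z R ∩ F.moranSet ω) : ℝ≥0∞)
      ≤ coveringNumber r (F.moranSet ω ∩ F.moranInterval ω n w) := by
        exact_mod_cast coveringNumber_mono (F.ball_inter_moranSet_subset ω hA hB hτ hzw h1')
    _ ≤ ENNReal.ofReal ((F.ratio ω n w / (A * (r / 2))) ^ s) :=
        F.coveringNumber_le_rpow ω hA hB hτ hs (by positivity) (by linarith) m w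
          ((lt_div_iff₀ hρ).1 hm).le hAr fun i _ => hsum _
    _ ≤ _ := by
        rw [← Real.mul_rpow (by positivity) (by positivity)]
        refine ENNReal.ofReal_le_ofReal (Real.rpow_le_rpow (by positivity) ?_ hs)
        calc F.ratio ω n w / (A * (r / 2)) ≤ R / (τ * A) / (A * (r / 2)) := by gcongr
          _ = 2 / (τ * A ^ 2) * (R / r) := by field_simp

theorem le_lowerPhiDim (hK : 0 < K) (hA : 0 < A) (hB : B < 1) (hτ : 0 < τ)
    {s : ℝ} (hs : 0 ≤ s) (hsum : ∀ n, 1 ≤ ∑ j, F.a j (ω n) ^ s) (Φ : ℝ → ℝ) :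
    s ≤ lowerPhiDim Φ (F.moranSet ω) := by
  refine le_sSup ⟨s, ⟨1, (τ * A / 2) ^ s, one_pos, le_rfl, by positivity, ?_⟩, rfl⟩
  intro r R hr hrR hRR hR z hz
  have hR0 : 0 < R := hr.trans_le (hrR.trans hRR)
  obtain ⟨n, w, hzw, h1, h2⟩ := F.exists_ratio_mem_Ico ω hA hB hz hR0 hR.le
  have hρ := F.ratio_pos ω hA n w
  obtain ⟨m, hm⟩ := exists_pow_lt_of_lt_one (show 0 < 2 * r / τ / F.ratio ω n w by positivity) hB
  calc ENNReal.ofReal ((τ * A / 2) ^ s * (R / r) ^ s)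
      ≤ ENNReal.ofReal ((F.ratio ω n w / (2 * r / τ)) ^ s) := by
        rw [← Real.mul_rpow (by positivity) (by positivity)]
        refine ENNReal.ofReal_le_ofReal (Real.rpow_le_rpow (by positivity) ?_ hs)
        calc τ * A / 2 * (R / r) = A * R / (2 * r / τ) := by field_simp
          _ ≤ F.ratio ω n w / (2 * r / τ) := by gcongr
    _ ≤ (coveringNumber r (F.moranSet ω ∩ F.moranInterval ω n w) : ℝ≥0∞) :=
        F.rpow_le_coveringNumber ω hK hA hB hτ hs (by positivity)
          (by rw [mul_div_cancel₀ _ hτ.ne']) m w ((lt_div_iff₀ hρ).1 hm).le fun i _ => hsum _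
    _ ≤ _ := by exact_mod_cast coveringNumber_mono (F.subset_ball_inter_moranSet ω hA hzw h2)

theorem le_upperPhiDim_of_frequently (hK : 0 < K) (hA : 0 < A) (hB : B < 1) (hτ : 0 < τ)
    {q : ℝ} (hq : 0 ≤ q) {b : ℕ} (hb : 2 ≤ b)
    (hrun : ∃ᶠ k in atTop, ∀ i < Nat.log b (k + 1), 1 ≤ ∑ j, F.a j (ω (k ^ 2 + i)) ^ q)
    {Φ : ℝ → ℝ} (hΦ : IsSmallDimensionFunction Φ) :
    q ≤ upperPhiDim Φ (F.moranSet ω) := by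
  refine le_sInf ?_
  rintro _ ⟨s, ⟨C₁, C₂, hC₁, -, hC₂, hs⟩, rfl⟩
  refine EReal.coe_le_coe_iff.2 (le_of_not_gt fun hsq => ?_)
  have hB0 : 0 < B := (a_pos hA ⟨0, hK⟩ (ω 0)).trans_le (a_le (F := F) hA ⟨0, hK⟩ (ω 0))
  -- `α = 2` puts the whole interval in the ball; `β = τ / 2` gives `2 * r = τ * x` for `x = B ^ m *
  -- ρ`, so that the stopping depth is exactly the run.
  have hscale := hΦ.eventually_scale hA hB0 hB (α := 2) (β := τ / 2) two_pos (by positivity)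
    hC₁ hb
  have hgrow := (tendsto_inv_pow_natLog hB0 hB hb).eventually
    (eventually_mul_rpow_lt (c := 1) (c' := C₂ * (4 / τ) ^ s) hsq one_pos)
  obtain ⟨k, hk, hsc, hgr⟩ := (hrun.and_eventually (hscale.and hgrow)).exists
  obtain ⟨z, hz, -⟩ := F.nonempty_moranSet_inter ω hK (n := 0) Fin.elim0
  obtain ⟨w, hw⟩ := mem_iUnion.1 (mem_iInter.1 hz (k ^ 2))
  have hρ := F.ratio_pos ω hA _ w
  obtain ⟨h1, h2, h3⟩ := hsc _ (F.pow_le_ratio ω hA _ w) (F.ratio_le_pow ω hA _ w)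
  generalize Nat.log b (k + 1) = m at *
  have hle := hs _ _ (by positivity) h2 h3 h1 z hz
  have hge := F.rpow_le_coveringNumber ω hK hA hB hτ hq (r := τ / 2 * (B ^ m * F.ratio ω _ w))
    (x := B ^ m * F.ratio ω _ w) (by positivity) (by linarith) m w le_rfl hk
  have hmono : (coveringNumber (τ / 2 * (B ^ m * F.ratio ω _ w))
      (F.moranSet ω ∩ F.moranInterval ω _ w) : ℝ≥0∞) ≤ coveringNumber
      (τ / 2 * (B ^ m * F.ratio ω _ w)) (Metric.ball z (2 * F.ratio ω _ w) ∩ F.moranSet ω) := by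
    exact_mod_cast coveringNumber_mono (F.subset_ball_inter_moranSet ω hA hw (by linarith))
  have hfin := (ENNReal.ofReal_le_ofReal_iff (by positivity)).1 ((hge.trans hmono).trans hle)
  have e1 : F.ratio ω _ w / (B ^ m * F.ratio ω _ w) = (B ^ m)⁻¹ := by field_simp
  have e2 : 2 * F.ratio ω _ w / (τ / 2 * (B ^ m * F.ratio ω _ w)) = 4 / τ * (B ^ m)⁻¹ := by
    field_simp
    norm_num
  rw [e1, e2, Real.mul_rpow (by positivity) (by positivity)] at hfin
  linarith

theorem lowerPhiDim_le_of_frequently (hK : 0 < K) (hA : 0 < A) (hA1 : A ≤ 1) (hB : B < 1)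
    (hτ : 0 < τ) {q : ℝ} (hq : 0 ≤ q) {b : ℕ} (hb : 2 ≤ b)
    (hrun : ∃ᶠ k in atTop, ∀ i < Nat.log b (k + 1), ∑ j, F.a j (ω (k ^ 2 + i)) ^ q ≤ 1)
    {Φ : ℝ → ℝ} (hΦ : IsSmallDimensionFunction Φ) :
    lowerPhiDim Φ (F.moranSet ω) ≤ q := by
  refine sSup_le ?_
  rintro _ ⟨s, ⟨C₁, C₂, hC₁, -, hC₂, hs⟩, rfl⟩
  refine EReal.coe_le_coe_iff.2 (le_of_not_gt fun hqs => ?_)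
  have hB0 : 0 < B := (a_pos hA ⟨0, hK⟩ (ω 0)).trans_le (a_le (F := F) hA ⟨0, hK⟩ (ω 0))
  -- `α = τ` confines the ball to one interval; `β = 2` makes `r` exceed `x = B ^ m * ρ`.
  have hscale := hΦ.eventually_scale hA hB0 hB (α := τ) (β := 2) hτ two_pos hC₁ hb
  have hgrow := (tendsto_inv_pow_natLog hB0 hB hb).eventually
    (eventually_mul_rpow_lt (c := C₂ * (τ / 2) ^ s) (c' := (A⁻¹) ^ q) hqs (by positivity))
  obtain ⟨k, hk, hsc, hgr⟩ := (hrun.and_eventually (hscale.and hgrow)).exists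
  obtain ⟨z, hz, -⟩ := F.nonempty_moranSet_inter ω hK (n := 0) Fin.elim0
  obtain ⟨w, hw⟩ := mem_iUnion.1 (mem_iInter.1 hz (k ^ 2))
  have hρ := F.ratio_pos ω hA _ w
  obtain ⟨h1, h2, h3⟩ := hsc _ (F.pow_le_ratio ω hA _ w) (F.ratio_le_pow ω hA _ w)
  generalize Nat.log b (k + 1) = m at *
  have hx : 0 < B ^ m * F.ratio ω _ w := by positivity
  have hle := hs _ _ (by positivity) h2 h3 h1 z hz
  have hge := F.coveringNumber_le_rpow ω hA hB hτ hq (r := 2 * (B ^ m * F.ratio ω _ w))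
    (x := B ^ m * F.ratio ω _ w) hx (by linarith) m w le_rfl
    (by
      rw [← mul_assoc]
      exact mul_le_of_le_one_left hρ.le
        (mul_le_one₀ hA1 (by positivity) (pow_le_one₀ hB0.le hB.le))) hk
  have hmono : (coveringNumber (2 * (B ^ m * F.ratio ω _ w))
      (Metric.ball z (τ * F.ratio ω _ w) ∩ F.moranSet ω) : ℝ≥0∞) ≤ coveringNumber
      (2 * (B ^ m * F.ratio ω _ w)) (F.moranSet ω ∩ F.moranInterval ω _ w) := by
    exact_mod_cast coveringNumber_mono (F.ball_inter_moranSet_subset ω hA hB hτ hw le_rfl)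
  have hfin := (ENNReal.ofReal_le_ofReal_iff (by positivity)).1 ((hle.trans hmono).trans hge)
  have e1 : F.ratio ω _ w / (A * (B ^ m * F.ratio ω _ w)) = A⁻¹ * (B ^ m)⁻¹ := by field_simp
  have e2 : τ * F.ratio ω _ w / (2 * (B ^ m * F.ratio ω _ w)) = τ / 2 * (B ^ m)⁻¹ := by
    field_simp
  rw [e1, e2, Real.mul_rpow (by positivity) (by positivity),
    Real.mul_rpow (by positivity) (by positivity)] at hfin
  linarith

/-! ### Translation between `F.dim` and power sums -/

theorem dim_nonneg (hK : 0 < K) (hA : 0 < A) (hB : B < 1) (ω₀ : Ω₀) : 0 ≤ F.dim ω₀ :=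
  (similarityDim_spec hK (fun j => a_pos hA j ω₀) ((F.sum_a_le ω₀).trans_lt hB)).1

theorem strictAnti_sum_rpow (hK : 0 < K) (hA : 0 < A) (hB : B < 1) (ω₀ : Ω₀) :
    StrictAnti fun s : ℝ => ∑ j, F.a j ω₀ ^ s := by
  intro x y hxy
  have : Nonempty (Fin K) := ⟨⟨0, hK⟩⟩
  exact Finset.sum_lt_sum_of_nonempty Finset.univ_nonempty fun j _ =>
    Real.rpow_lt_rpow_of_exponent_gt (a_pos hA j ω₀) ((a_le hA j ω₀).trans_lt hB) hxy

theorem sum_rpow_dim (hK : 0 < K) (hA : 0 < A) (hB : B < 1) (ω₀ : Ω₀) :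
    ∑ j, F.a j ω₀ ^ F.dim ω₀ = 1 :=
  (similarityDim_spec hK (fun j => a_pos hA j ω₀) ((F.sum_a_le ω₀).trans_lt hB)).2

/-- Expresses the level sets of `F.dim` through power sums, whose measurability is immediate, so
`F.dim` itself need not be shown measurable. -/
theorem sum_rpow_le_one_iff (hK : 0 < K) (hA : 0 < A) (hB : B < 1) {ω₀ : Ω₀} {s : ℝ} :
    ∑ j, F.a j ω₀ ^ s ≤ 1 ↔ F.dim ω₀ ≤ s := by
  rw [← F.sum_rpow_dim hK hA hB ω₀]
  exact (F.strictAnti_sum_rpow hK hA hB ω₀).le_iff_ge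

theorem one_le_sum_rpow_iff (hK : 0 < K) (hA : 0 < A) (hB : B < 1) {ω₀ : Ω₀} {s : ℝ} :
    1 ≤ ∑ j, F.a j ω₀ ^ s ↔ s ≤ F.dim ω₀ := by
  rw [← F.sum_rpow_dim hK hA hB ω₀]
  exact (F.strictAnti_sum_rpow hK hA hB ω₀).le_iff_ge

theorem measurable_sum_rpow (s : ℝ) : Measurable fun ω₀ => ∑ j, F.a j ω₀ ^ s :=
  Finset.measurable_sum _ fun j _ => (F.measurable_a j).pow_const s

end RandomIFS

end RandomMoran

/-! ### The almost sure dimensions -/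

open RandomMoran RandomIFS in
theorem mainTheorem1 {Ω₀ : Type*} [MeasurableSpace Ω₀] (P : Measure Ω₀) [IsProbabilityMeasure P]
    (K : ℕ) (hK : 2 ≤ K) (A B τ : ℝ) (hA : 0 < A) (hτ : 0 < τ)
    (hKAB : K * A ≤ B) (hB : B < 1) (hτB : τ ≤ (1 - B) / K)
    (F : RandomMoran.RandomIFS Ω₀ K A B τ) :
    ∃ Γ : Set (ℕ → Ω₀), MeasurableSet Γ ∧ Measure.infinitePi (fun _ : ℕ => P) Γ = 1 ∧
      ∀ ω ∈ Γ, ∀ Φ : ℝ → ℝ, RandomMoran.IsSmallDimensionFunction Φ →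
        RandomMoran.upperPhiDim Φ (F.moranSet ω) = essSup (fun ω₀ => (F.dim ω₀ : EReal)) P ∧
        RandomMoran.lowerPhiDim Φ (F.moranSet ω) = essInf (fun ω₀ => (F.dim ω₀ : EReal)) P := by
  have hK0 : 0 < K := by omega
  have hKR : (1 : ℝ) ≤ K := by exact_mod_cast hK0
  have hA1 : A ≤ 1 := by nlinarith
  have hB0 : 0 < B := by nlinarith
  have hτ1 : τ ≤ 1 := hτB.trans ((div_le_one (by positivity)).2 (by linarith))
  -- With `P G ≠ 0` under the quantifier, the statement can be intersected over all rational `q` at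
  -- once.
  have hrun : ∀ G : Set Ω₀, MeasurableSet G → ∀ᵐ ω ∂(Measure.infinitePi fun _ : ℕ => P),
      P G ≠ 0 → ∃ b : ℕ, 2 ≤ b ∧ ∃ᶠ k in atTop, ∀ i < Nat.log b (k + 1), ω (k ^ 2 + i) ∈ G := by
    intro G hG
    by_cases hPG : P G = 0
    · exact Eventually.of_forall fun _ h => absurd hPG h
    · obtain ⟨b, hb, hae⟩ := exists_ae_frequently_run P hG hPG
      exact hae.mono fun ω hω _ => ⟨b, hb, hω⟩
  have hbound : ∀ᵐ ω ∂(Measure.infinitePi fun _ : ℕ => P), ∀ n,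
      (F.dim (ω n) : EReal) ≤ essSup (fun ω₀ => (F.dim ω₀ : EReal)) P ∧
      essInf (fun ω₀ => (F.dim ω₀ : EReal)) P ≤ F.dim (ω n) :=
    ae_all_iff.2 fun n =>
      (measurePreserving_eval_infinitePi (fun _ : ℕ => P) n).quasiMeasurePreserving.ae
        ((ae_le_essSup (f := fun ω₀ => (F.dim ω₀ : EReal))).and
          (ae_essInf_le (f := fun ω₀ => (F.dim ω₀ : EReal))))
  have hup := ae_all_iff.2 fun q : ℚ => hrun {ω₀ | 1 ≤ ∑ j, F.a j ω₀ ^ (q : ℝ)}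
    (measurableSet_le measurable_const (F.measurable_sum_rpow q))
  have hlow := ae_all_iff.2 fun q : ℚ => hrun {ω₀ | ∑ j, F.a j ω₀ ^ (q : ℝ) ≤ 1}
    (measurableSet_le (F.measurable_sum_rpow q) measurable_const)
  obtain ⟨Γ, hΓ, hΓm, hΓp⟩ := (hbound.and (hup.and hlow)).exists_measurable_mem
  refine ⟨Γ, hΓm, (mem_ae_iff_prob_eq_one hΓm).1 hΓ, fun ω hω Φ hΦ => ?_⟩
  obtain ⟨hbd, hup, hlow⟩ := hΓp ω hω
  refine ⟨le_antisymm ?_ ?_, le_antisymm ?_ ?_⟩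
  · refine EReal.le_of_forall_lt_iff_le.1 fun s hs => ?_
    have hdim : ∀ n, F.dim (ω n) ≤ s := fun n =>
      EReal.coe_le_coe_iff.1 ((hbd n).1.trans hs.le)
    exact F.upperPhiDim_le ω hA hA1 hB hτ hτ1 ((F.dim_nonneg hK0 hA hB _).trans (hdim 0))
      (fun n => (F.sum_rpow_le_one_iff hK0 hA hB).2 (hdim n)) Φ
  · refine EReal.ge_of_forall_gt_iff_ge.1 fun s hs => ?_
    obtain ⟨q, hsq, hq⟩ := EReal.lt_iff_exists_rat_btwn.1 hs
    have hsq : s < q := by exact_mod_cast hsq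
    rcases le_or_gt 0 (q : ℝ) with hq0 | hq0
    · obtain ⟨b, hb, hfreq⟩ := hup q fun h0 => hq.not_ge <| by
        refine essSup_le_of_ae_le _ ?_
        filter_upwards [measure_eq_zero_iff_ae_notMem.1 h0] with ω₀ h
        rw [F.one_le_sum_rpow_iff hK0 hA hB, not_le] at h
        exact_mod_cast h.le
      exact (EReal.coe_le_coe_iff.2 hsq.le).trans
        (F.le_upperPhiDim_of_frequently ω hK0 hA hB hτ hq0 hb hfreq hΦ)
    -- For negative `q` use exponent `0` instead: the power sum is `K ≥ 1`, so every block is a run,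
    -- with base `2`.
    · refine (EReal.coe_le_coe_iff.2 (hsq.trans hq0).le).trans
        (F.le_upperPhiDim_of_frequently ω hK0 hA hB hτ le_rfl le_rfl ?_ hΦ)
      exact Frequently.of_forall fun k i _ => by simpa using hKR
  · refine EReal.le_of_forall_lt_iff_le.1 fun s hs => ?_
    obtain ⟨q, hq, hqs⟩ := EReal.lt_iff_exists_rat_btwn.1 hs
    have hqs : (q : ℝ) < s := by exact_mod_cast hqs
    have hne : P {ω₀ | ∑ j, F.a j ω₀ ^ (q : ℝ) ≤ 1} ≠ 0 := fun h0 => hq.not_ge <| by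
      refine le_essInf_of_ae_le _ ?_
      filter_upwards [measure_eq_zero_iff_ae_notMem.1 h0] with ω₀ h
      rw [F.sum_rpow_le_one_iff hK0 hA hB, not_le] at h
      exact_mod_cast h.le
    obtain ⟨b, hb, hfreq⟩ := hlow q hne
    obtain ⟨ω₀, hω₀⟩ := nonempty_of_measure_ne_zero hne
    have hq0 := (F.dim_nonneg hK0 hA hB ω₀).trans ((F.sum_rpow_le_one_iff hK0 hA hB).1 hω₀)
    exact (F.lowerPhiDim_le_of_frequently ω hK0 hA hA1 hB hτ hq0 hb hfreq hΦ).trans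
      (EReal.coe_le_coe_iff.2 hqs.le)
  · refine EReal.ge_of_forall_gt_iff_ge.1 fun s hs => ?_
    -- `s` may be negative, but the covering bound needs a nonnegative exponent.
    have hdim : ∀ n, max s 0 ≤ F.dim (ω n) := fun n =>
      max_le (EReal.coe_le_coe_iff.1 (hs.le.trans (hbd n).2)) (F.dim_nonneg hK0 hA hB _)
    exact (EReal.coe_le_coe_iff.2 (le_max_left s 0)).trans
      (F.le_lowerPhiDim ω hK0 hA hB hτ (le_max_right s 0)
        (fun n => (F.one_le_sum_rpow_iff hK0 hA hB).2 (hdim n)) Φ)
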